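/- For complex numbers $a, q$ and integers $n\ge 0$ write $(a;q)_n=\prod_{k=0}^{n-1}(1-aq^k)$ and, for $|q|<1$, $(a;q)_\infty=\prod_{k=0}^{\infty}(1-aq^k)$ and $(a_1,\dots,a_m;q)_\infty=(a_1;q)_\infty\cdots(a_m;q)_\infty$. Let $q\in\mathbb{C}$ with $|q|<1$. Then the following series converges absolutely, and $$\sum_{n=0}^{\infty}\frac{q^{(n^2+3n)/2}\,(-q;q)_n}{(q;q^2)_{n+1}\,(q;q)_{n+1}}=\frac{(q^{10};q^{10})_\infty}{(q;q)_\infty\,(q;q^2)_\infty\,(-q^3,-q^4,-q^6,-q^7;q^{10})_\infty}.$$ -/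

import Mathlib

/-- The finite `q`-shifted factorial `(a; q)_n = ∏_{k = 0}^{n - 1} (1 - a q^k)`. -/
noncomputable def qPoch (a q : ℂ) (n : ℕ) : ℂ :=
  ∏ k ∈ Finset.range n, (1 - a * q ^ k)

/-- The infinite `q`-shifted factorial `(a; q)_∞ = ∏_{k ≥ 0} (1 - a q^k)`, for `‖q‖ < 1`. -/
noncomputable def qPochInf (a q : ℂ) : ℂ :=
  ∏' k : ℕ, (1 - a * q ^ k)

/-- The product defining `(a; q)_∞` converges absolutely when `‖q‖ < 1`. -/
theorem hasProd_qPochInf (a : ℂ) {q : ℂ} (hq : ‖q‖ < 1) :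
    HasProd (fun k : ℕ => 1 - a * q ^ k) (qPochInf a q) := by
  have hs : Summable (fun k : ℕ => ‖-(a * q ^ k)‖) := by
    simpa [norm_mul, norm_pow] using
      (summable_geometric_of_lt_one (norm_nonneg q) hq).mul_left ‖a‖
  have h := multipliable_one_add_of_summable hs
  simp only [← sub_eq_add_neg] at h
  exact h.hasProd

/-- `(a; q)_n` is the `n`-th partial product of `(a; q)_∞`. -/
theorem tendsto_qPoch (a : ℂ) {q : ℂ} (hq : ‖q‖ < 1) :
    Filter.Tendsto (qPoch a q) Filter.atTop (nhds (qPochInf a q)) :=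
  (hasProd_qPochInf a hq).tendsto_prod_nat

/-- None of the factors of `(a; q)_n` and `(a; q)_∞` vanishes when `‖a‖ < 1` and `‖q‖ < 1`. -/
theorem qPoch_factor_ne_zero {a q : ℂ} (ha : ‖a‖ < 1) (hq : ‖q‖ < 1) (k : ℕ) :
    1 - a * q ^ k ≠ 0 := by
  intro h
  have h1 : ‖a * q ^ k‖ = 1 := by rw [← sub_eq_zero.mp h, norm_one]
  have h2 : ‖a * q ^ k‖ ≤ ‖a‖ := by
    rw [norm_mul, norm_pow]
    exact mul_le_of_le_one_right (norm_nonneg a) (pow_le_one₀ (norm_nonneg q) hq.le)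
  linarith

theorem qPoch_ne_zero {a q : ℂ} (ha : ‖a‖ < 1) (hq : ‖q‖ < 1) (n : ℕ) :
    qPoch a q n ≠ 0 :=
  Finset.prod_ne_zero_iff.mpr fun k _ => qPoch_factor_ne_zero ha hq k

theorem qPochInf_ne_zero {a q : ℂ} (ha : ‖a‖ < 1) (hq : ‖q‖ < 1) :
    qPochInf a q ≠ 0 := by
  have hs : Summable (fun k : ℕ => ‖-(a * q ^ k)‖) := by
    simpa [norm_mul, norm_pow] using
      (summable_geometric_of_lt_one (norm_nonneg q) hq).mul_left ‖a‖
  have h := tprod_one_add_ne_zero_of_summable (f := fun k : ℕ => -(a * q ^ k))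
    (fun k => by simpa [← sub_eq_add_neg] using qPoch_factor_ne_zero ha hq k) hs
  simpa only [qPochInf, ← sub_eq_add_neg] using h

/-!
Multiplied by `2q`, the series is a tail of

  `∑_{n ≥ 0} (-1; q)_n q ^ (n (n + 1) / 2) β_n`,  with `β_n = 1 / ((q; q ^ 2)_n (q; q)_n)`,

whose term for `n = 0` is `1`. The numbers `β_n` form a Bailey pair relative to `1` (`bailey_pair`):
`β_n` is the sum of `(-1) ^ s q ^ (3 s ^ 2 + s) / ((q; q)_{n - 2s} (q; q)_{n + 2s})` over `s ∈ ℤ`.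
Bailey's lemma with the parameters `-1` and `∞` then evaluates the full series: after an exchange of
the order of summation the inner sums over `n` are limiting `q`-Gauss sums (`q_gauss_sum`,
`conjugate_bailey_pair`), and what remains is a theta series (`hasSum_bailey`), so that

  `1 + 2q · (series) = (-q; q)_∞ / (q; q)_∞ · ∑_{s ∈ ℤ} (-1) ^ s q ^ (5 s ^ 2)`.

It remains to see that the right-hand side minus `1` is `2q` times the asserted product
(`product_identity`). By the Jacobi triple product and Euler's identity
`(q; q ^ 2)_∞ (-q; q)_∞ = 1`, for `q` and for `q ^ 5`, this is a three-term relation among products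
of four theta functions of nome `q ^ 5` (`theta_identity`). That relation follows from the formula
`thetaSeries_mul`, which writes a product of two theta series through theta series of the squared
nome.

Bilateral sums over `ℤ` use the convention `1 / (q; q)_m = 0` for `m < 0` (`invPoch`), under which
the recurrence in `m` holds without exception. Integer powers of `q` are meaningful for `q ≠ 0`
only; the case `q = 0` of the theorem is immediate.
-/

open Filter Topology

/-! ### Shifted factorials and their reciprocals -/

theorem norm_pow_lt_one {q : ℂ} (hq : ‖q‖ < 1) {m : ℕ} (hm : m ≠ 0) : ‖q ^ m‖ < 1 := by
  rw [norm_pow]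
  exact pow_lt_one₀ (norm_nonneg q) hq hm

theorem qPoch_succ (a q : ℂ) (n : ℕ) :
    qPoch a q (n + 1) = qPoch a q n * (1 - a * q ^ n) := by
  simp [qPoch, Finset.prod_range_succ]

@[simp] theorem qPoch_zero (a q : ℂ) : qPoch a q 0 = 1 := by simp [qPoch]

theorem qPoch_add (a q : ℂ) (m n : ℕ) :
    qPoch a q (m + n) = qPoch a q m * qPoch (a * q ^ m) q n := by
  simp [qPoch, Finset.prod_range_add, pow_add, mul_assoc]

theorem qPochInf_eq_mul (a : ℂ) {q : ℂ} (hq : ‖q‖ < 1) (m : ℕ) :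
    qPochInf a q = qPoch a q m * qPochInf (a * q ^ m) q := by
  have h1 : Tendsto (fun n => qPoch a q (m + n)) atTop (𝓝 (qPochInf a q)) := by
    simpa only [add_comm m] using (tendsto_add_atTop_iff_nat m).2 (tendsto_qPoch a hq)
  refine tendsto_nhds_unique h1 ?_
  simp only [qPoch_add]
  exact (tendsto_qPoch _ hq).const_mul _

theorem exists_norm_qPoch_le (a : ℂ) {q : ℂ} (hq : ‖q‖ < 1) :
    ∃ K : ℝ, 0 ≤ K ∧ ∀ n, ‖qPoch a q n‖ ≤ K := by
  obtain ⟨K, hK⟩ := (Metric.isBounded_range_of_tendsto _ (tendsto_qPoch a hq)).exists_norm_le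
  exact ⟨K, (norm_nonneg _).trans (hK _ ⟨0, rfl⟩), fun n => hK _ ⟨n, rfl⟩⟩

/-- The reciprocal `1 / (q; q)_m` for an integer `m`, with the usual convention that it vanishes
for `m < 0`. -/
noncomputable def invPoch (q : ℂ) (m : ℤ) : ℂ :=
  if 0 ≤ m then (qPoch q q m.toNat)⁻¹ else 0

@[simp] theorem invPoch_natCast (q : ℂ) (m : ℕ) : invPoch q m = (qPoch q q m)⁻¹ := by
  simp [invPoch]

theorem invPoch_of_neg (q : ℂ) {m : ℤ} (hm : m < 0) : invPoch q m = 0 := by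
  simp [invPoch, hm]

@[simp] theorem invPoch_zero (q : ℂ) : invPoch q 0 = 1 := by simp [invPoch]

/-- The recurrence `1 / (q; q)_{m - 1} = (1 - q ^ m) / (q; q)_m` holds for every integer `m`; at
`m = 0` both sides vanish. -/
theorem invPoch_sub_one {q : ℂ} (hq : ‖q‖ < 1) (m : ℤ) :
    invPoch q (m - 1) = (1 - q ^ m) * invPoch q m := by
  rcases lt_trichotomy m 0 with hm | rfl | hm
  · rw [invPoch_of_neg q hm, invPoch_of_neg q (by lia), mul_zero]
  · rw [invPoch_of_neg q (by lia)]; simp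
  · obtain ⟨n, rfl⟩ : ∃ n : ℕ, m = (n + 1 : ℕ) := ⟨(m - 1).toNat, by lia⟩
    rw [show ((n + 1 : ℕ) : ℤ) - 1 = (n : ℕ) by push_cast; ring, invPoch_natCast,
      invPoch_natCast, qPoch_succ, zpow_natCast, pow_succ']
    have := qPoch_factor_ne_zero hq hq n
    field_simp

theorem exists_norm_invPoch_le {q : ℂ} (hq : ‖q‖ < 1) :
    ∃ K : ℝ, 0 ≤ K ∧ ∀ m, ‖invPoch q m‖ ≤ K := by
  have h := (tendsto_qPoch q hq).inv₀ (qPochInf_ne_zero hq hq)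
  obtain ⟨K, hK⟩ := (Metric.isBounded_range_of_tendsto _ h).exists_norm_le
  have hK0 : 0 ≤ K := (norm_nonneg _).trans (hK _ ⟨0, rfl⟩)
  refine ⟨K, hK0, fun m => ?_⟩
  rcases lt_or_ge m 0 with hm | hm
  · simpa [invPoch_of_neg q hm] using hK0
  · lift m to ℕ using hm
    rw [invPoch_natCast]
    exact hK _ ⟨m, rfl⟩

theorem tendsto_invPoch {q : ℂ} (hq : ‖q‖ < 1) :
    Tendsto (invPoch q) atTop (𝓝 (qPochInf q q)⁻¹) := by
  have h := (tendsto_qPoch q hq).inv₀ (qPochInf_ne_zero hq hq)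
  have h2 : Tendsto Int.toNat atTop atTop :=
    tendsto_atTop.2 fun n => (eventually_ge_atTop (n : ℤ)).mono fun m hm => by lia
  refine (h.comp h2).congr' ((eventually_ge_atTop 0).mono fun m hm => ?_)
  simp [invPoch, hm]

/-! ### Theta series and the Jacobi triple product -/

theorem summable_norm_pow_mul_pow_sq (z : ℂ) {q : ℂ} (hz : z ≠ 0) (hq0 : q ≠ 0) (hq : ‖q‖ < 1) :
    Summable fun k : ℕ => ‖z ^ k * q ^ (k ^ 2)‖ := by
  refine summable_of_ratio_test_tendsto_lt_one (l := 0) one_pos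
    (Eventually.of_forall fun k =>
      norm_ne_zero_iff.2 (mul_ne_zero (pow_ne_zero _ hz) (pow_ne_zero _ hq0))) ?_
  have h : Tendsto (fun k : ℕ => ‖z‖ * ‖q‖ * (‖q‖ ^ 2) ^ k) atTop (𝓝 (‖z‖ * ‖q‖ * 0)) :=
    (tendsto_pow_atTop_nhds_zero_of_lt_one (by positivity)
      (pow_lt_one₀ (norm_nonneg q) hq two_ne_zero)).const_mul _
  rw [mul_zero] at h
  refine h.congr fun k => ?_
  have hq1 : ‖q‖ ≠ 0 := norm_ne_zero_iff.2 hq0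
  have hz1 : ‖z‖ ≠ 0 := norm_ne_zero_iff.2 hz
  simp only [norm_mul, norm_pow, norm_norm]
  rw [eq_div_iff (mul_ne_zero (pow_ne_zero _ hz1) (pow_ne_zero _ hq1))]
  ring

/-- Absolute convergence of the theta series. -/
theorem summable_norm_theta {z q : ℂ} (hz : z ≠ 0) (hq0 : q ≠ 0) (hq : ‖q‖ < 1) :
    Summable fun k : ℤ => ‖z ^ k * q ^ (k ^ 2)‖ := by
  refine Summable.of_nat_of_neg ?_ ?_
  · exact_mod_cast summable_norm_pow_mul_pow_sq z hz hq0 hq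
  · refine (summable_norm_pow_mul_pow_sq z⁻¹ (inv_ne_zero hz) hq0 hq).congr fun k => ?_
    rw [zpow_neg, zpow_natCast, inv_pow, neg_sq]
    norm_cast

/-- The terms of a theta series remain summable after multiplication by two reciprocals
`1 / (p; p)_m`, `1 / (p; p)_m'` whose indices depend on the summation variable. -/
theorem summable_theta_mul_invPoch {z q p : ℂ} (hz : z ≠ 0) (hq0 : q ≠ 0) (hq : ‖q‖ < 1)
    (hp : ‖p‖ < 1) (f g : ℤ → ℤ) :
    Summable fun k : ℤ => z ^ k * q ^ (k ^ 2) * (invPoch p (f k) * invPoch p (g k)) := by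
  obtain ⟨K, hK0, hK⟩ := exists_norm_invPoch_le hp
  refine Summable.of_norm_bounded ((summable_norm_theta hz hq0 hq).mul_right (K * K)) fun k => ?_
  rw [norm_mul _ (_ * _), norm_mul (invPoch _ _)]
  gcongr <;> exact hK _

/-- The theta series `∑_{k ∈ ℤ} z ^ k q ^ (k ^ 2)`. -/
noncomputable def thetaSeries (z q : ℂ) : ℂ :=
  ∑' k : ℤ, z ^ k * q ^ (k ^ 2)

/-- A finite form of the Jacobi triple product, equivalent to the `q`-binomial theorem. The
sum over `k` satisfies a two-term recurrence in `n`, because multiplying by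
`(1 + z q ^ (2n + 1)) (1 + q ^ (2n + 1) / z)` mixes only neighbouring terms. -/
theorem finite_jacobi_triple_product {z q : ℂ} (hz : z ≠ 0) (hq0 : q ≠ 0) (hq : ‖q‖ < 1) (n : ℕ) :
    qPoch (q ^ 2) (q ^ 2) (2 * n) * ∑' k : ℤ, z ^ k * q ^ (k ^ 2) *
        (invPoch (q ^ 2) (n - k) * invPoch (q ^ 2) (n + k)) =
      qPoch (-(z * q)) (q ^ 2) n * qPoch (-(q / z)) (q ^ 2) n := by
  have hp : ‖q ^ 2‖ < 1 := norm_pow_lt_one hq two_ne_zero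
  induction n with
  | zero =>
    rw [tsum_eq_single 0]
    · simp
    · intro k hk
      rcases lt_or_gt_of_ne hk with h | h
      · rw [invPoch_of_neg (m := ((0 : ℕ) : ℤ) + k) _ (by lia)]; simp
      · rw [invPoch_of_neg (m := ((0 : ℕ) : ℤ) - k) _ (by lia)]; simp
  | succ n ih =>
    set T : ℕ → ℤ → ℂ := fun n k => z ^ k * q ^ (k ^ 2) *
        (invPoch (q ^ 2) (n - k) * invPoch (q ^ 2) (n + k)) with hT
    have hs : ∀ n, Summable (T n) := fun n => summable_theta_mul_invPoch hz hq0 hq hp _ _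
    -- After a shift of `k`, all three series on the right are the sum of `T n`.
    have key : ∀ k, (1 - (q ^ 2) ^ (2 * n + 1)) * (1 - (q ^ 2) ^ (2 * n + 2)) * T (n + 1) k =
        (1 + (q ^ 2) ^ (2 * n + 1)) * T n k + z * q ^ (2 * n + 1) * T n (k + -1) +
          q ^ (2 * n + 1) / z * T n (k + 1) := by
      intro k
      have e1 : ∀ m : ℤ, invPoch (q ^ 2) (m - 1) = (1 - (q ^ 2) ^ m) * invPoch (q ^ 2) m :=
        invPoch_sub_one hp
      simp only [hT]
      rw [show (n : ℤ) - k = (((n + 1 : ℕ) : ℤ) - k) - 1 by push_cast; ring,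
        show (n : ℤ) + k = (((n + 1 : ℕ) : ℤ) + k) - 1 by push_cast; ring,
        show (n : ℤ) - (k + 1) = (((n + 1 : ℕ) : ℤ) - k) - 1 - 1 by push_cast; ring,
        show (n : ℤ) + (k + -1) = (((n + 1 : ℕ) : ℤ) + k) - 1 - 1 by push_cast; ring,
        show (n : ℤ) - (k + -1) = (((n + 1 : ℕ) : ℤ) - k) by push_cast; ring,
        show (n : ℤ) + (k + 1) = (((n + 1 : ℕ) : ℤ) + k) by push_cast; ring]
      simp only [e1]
      generalize invPoch (q ^ 2) (((n + 1 : ℕ) : ℤ) - k) = A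
      generalize invPoch (q ^ 2) (((n + 1 : ℕ) : ℤ) + k) = B
      have hk : ∀ m : ℤ, (q ^ 2) ^ m = (q ^ m) ^ 2 := fun m => by
        rw [← zpow_natCast, ← zpow_natCast, ← zpow_mul, ← zpow_mul, mul_comm]
      rw [show (k + -1) ^ 2 = k ^ 2 - k - k + 1 by ring,
        show (k + 1) ^ 2 = k ^ 2 + k + k + 1 by ring]
      simp only [hk, zpow_add₀ hq0, zpow_sub₀ hq0, zpow_add₀ hz, Nat.cast_add, Nat.cast_one,
        zpow_natCast, zpow_one, zpow_neg]
      have hX : q ^ k ≠ 0 := zpow_ne_zero _ hq0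
      have hY : q ^ n ≠ 0 := pow_ne_zero _ hq0
      have eY : q ^ (2 * n + 1) = q * (q ^ n) ^ 2 := by ring
      have eY1 : (q ^ 2) ^ (2 * n + 1) = q ^ 2 * (q ^ n) ^ 4 := by ring
      have eY2 : (q ^ 2) ^ (2 * n + 2) = q ^ 4 * (q ^ n) ^ 4 := by ring
      rw [eY, eY1, eY2]
      generalize q ^ k = X at *
      generalize q ^ n = Y at *
      generalize q ^ k ^ 2 = W at *
      generalize z ^ k = Z at *
      field_simp
      ring
    have hsum := tsum_congr (L := .unconditional ℤ) key
    have h1 := ((Equiv.addRight (-1 : ℤ)).summable_iff (f := T n)).2 (hs n)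
    have h2 := ((Equiv.addRight (1 : ℤ)).summable_iff (f := T n)).2 (hs n)
    have t1 := (Equiv.addRight (-1 : ℤ)).tsum_eq (T n)
    have t2 := (Equiv.addRight (1 : ℤ)).tsum_eq (T n)
    simp only [Function.comp_def, Equiv.coe_addRight] at h1 h2 t1 t2
    rw [Summable.tsum_add (((hs n).mul_left _).add (h1.mul_left _)) (h2.mul_left _),
      Summable.tsum_add ((hs n).mul_left _) (h1.mul_left _), tsum_mul_left, tsum_mul_left,
      tsum_mul_left, tsum_mul_left, t1, t2] at hsum
    rw [qPoch_succ, qPoch_succ, show 2 * (n + 1) = 2 * n + 1 + 1 by ring, qPoch_succ, qPoch_succ]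
    have e : ∀ m, q ^ 2 * (q ^ 2) ^ m = (q ^ 2) ^ (m + 1) := fun m => by ring
    simp only [e]
    calc _ = qPoch (q ^ 2) (q ^ 2) (2 * n) * ((1 - (q ^ 2) ^ (2 * n + 1)) *
          (1 - (q ^ 2) ^ (2 * n + 2)) * ∑' k, T (n + 1) k) := by ring
      _ = (qPoch (q ^ 2) (q ^ 2) (2 * n) * ∑' k, T n k) *
          ((1 + (q ^ 2) ^ (2 * n + 1)) + z * q ^ (2 * n + 1) + q ^ (2 * n + 1) / z) := by
        rw [hsum]; ring
      _ = _ := by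
        rw [ih]
        field_simp
        ring

/-- The Jacobi triple product, as the limit of its finite form by dominated convergence. -/
theorem jacobi_triple_product {z q : ℂ} (hz : z ≠ 0) (hq0 : q ≠ 0) (hq : ‖q‖ < 1) :
    thetaSeries z q =
      qPochInf (-(z * q)) (q ^ 2) * qPochInf (-(q / z)) (q ^ 2) * qPochInf (q ^ 2) (q ^ 2) := by
  have hp : ‖q ^ 2‖ < 1 := norm_pow_lt_one hq two_ne_zero
  obtain ⟨K, hK0, hK⟩ := exists_norm_invPoch_le hp
  set E := qPochInf (q ^ 2) (q ^ 2) with hE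
  have hE0 : E ≠ 0 := qPochInf_ne_zero hp hp
  have hlim : Tendsto (fun n : ℕ => ∑' k : ℤ, z ^ k * q ^ (k ^ 2) *
        (invPoch (q ^ 2) (n - k) * invPoch (q ^ 2) (n + k))) atTop
      (𝓝 (∑' k : ℤ, z ^ k * q ^ (k ^ 2) * (E⁻¹ * E⁻¹))) := by
    refine tendsto_tsum_of_dominated_convergence
      ((summable_norm_theta hz hq0 hq).mul_right (K * K)) (fun k => ?_)
      (Eventually.of_forall fun n k => ?_)
    · refine (Tendsto.mul ?_ ?_).const_mul _
      · exact (tendsto_invPoch hp).comp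
          (tendsto_atTop_add_const_right _ (-k) tendsto_natCast_atTop_atTop)
      · exact (tendsto_invPoch hp).comp
          (tendsto_atTop_add_const_right _ k tendsto_natCast_atTop_atTop)
    · rw [norm_mul _ (_ * _), norm_mul (invPoch _ _)]
      gcongr <;> exact hK _
  have h2n : Tendsto (fun n : ℕ => 2 * n) atTop atTop :=
    tendsto_id.const_mul_atTop' two_pos
  have hl := ((tendsto_qPoch (q ^ 2) hp).comp h2n).mul hlim
  simp only [Function.comp_def, finite_jacobi_triple_product hz hq0 hq] at hl
  have := tendsto_nhds_unique hl ((tendsto_qPoch _ hp).mul (tendsto_qPoch _ hp))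
  rw [tsum_mul_right, ← hE] at this
  rw [← this, thetaSeries]
  field_simp

/-- The parity splitting of `ℤ × ℤ`: a pair with even coordinate sum is `(u + v, u - v)`, and a pair
with odd coordinate sum is `(u + v + 1, u - v)`. -/
def paritySplit : (ℤ × ℤ) ⊕ (ℤ × ℤ) ≃ ℤ × ℤ where
  toFun
    | .inl (u, v) => (u + v, u - v)
    | .inr (u, v) => (u + v + 1, u - v)
  invFun
    | (m, n) => if (m + n) % 2 = 0 then .inl ((m + n) / 2, (m - n) / 2)
      else .inr ((m + n) / 2, (m - n) / 2)
  left_inv := by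
    rintro (⟨u, v⟩ | ⟨u, v⟩)
    · change (if (u + v + (u - v)) % 2 = 0 then _ else _) = _
      rw [if_pos (by lia)]
      congr 2 <;> lia
    · change (if (u + v + 1 + (u - v)) % 2 = 0 then _ else _) = _
      rw [if_neg (by lia)]
      congr 2 <;> lia
  right_inv := by
    rintro ⟨m, n⟩
    by_cases h : (m + n) % 2 = 0
    · simp only [h, if_true, Prod.mk.injEq]
      lia
    · simp only [h, if_false, Prod.mk.injEq]
      lia

theorem thetaSeries_inv (z q : ℂ) : thetaSeries z⁻¹ q = thetaSeries z q := by
  rw [thetaSeries, thetaSeries, ← (Equiv.neg ℤ).tsum_eq]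
  simp

/-- The product of two theta series in nome `q` is a sum of two such products in nome `q ^ 2`: the
double series over `(m, n)` splits according to the parity of `m + n`. -/
theorem thetaSeries_mul {x y q : ℂ} (hx : x ≠ 0) (hy : y ≠ 0) (hq0 : q ≠ 0) (hq : ‖q‖ < 1) :
    thetaSeries x q * thetaSeries y q =
      thetaSeries (x * y) (q ^ 2) * thetaSeries (x / y) (q ^ 2) +
        q / x * (thetaSeries (q ^ 2 / (x * y)) (q ^ 2) * thetaSeries (q ^ 2 * y / x) (q ^ 2)) := by
  have hp : ‖q ^ 2‖ < 1 := norm_pow_lt_one hq two_ne_zero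
  have hp0 : q ^ 2 ≠ 0 := pow_ne_zero _ hq0
  have key : ∀ {a b : ℂ}, a ≠ 0 → b ≠ 0 → ∀ {r : ℂ}, r ≠ 0 → ‖r‖ < 1 →
      HasSum (fun k : ℤ × ℤ => (a ^ k.1 * r ^ (k.1 ^ 2)) * (b ^ k.2 * r ^ (k.2 ^ 2)))
        (thetaSeries a r * thetaSeries b r) := by
    intro a b ha hb r hr0 hr
    have h1 := summable_norm_theta ha hr0 hr
    have h2 := summable_norm_theta hb hr0 hr
    rw [thetaSeries, thetaSeries, tsum_mul_tsum_of_summable_norm h1 h2]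
    exact (summable_mul_of_summable_norm h1 h2).hasSum
  -- Expanding in inverse powers of `x` and `y` produces the right-hand side in the stated form.
  have hL := paritySplit.hasSum_iff.2 (key (inv_ne_zero hx) (inv_ne_zero hy) hq0 hq)
  rw [thetaSeries_inv, thetaSeries_inv] at hL
  have hA := key (inv_ne_zero (mul_ne_zero hx hy)) (inv_ne_zero (div_ne_zero hx hy)) hp0 hp
  rw [thetaSeries_inv, thetaSeries_inv] at hA
  have hB := (key (div_ne_zero hp0 (mul_ne_zero hx hy)) (div_ne_zero (mul_ne_zero hp0 hy) hx)
    hp0 hp).mul_left (q / x)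
  have hpow : ∀ m : ℤ, (q ^ 2) ^ m = q ^ (2 * m) := fun m => by
    rw [← zpow_natCast, ← zpow_mul]; norm_num
  refine hL.unique (HasSum.sum ?_ ?_)
  · refine hA.congr_fun ?_
    rintro ⟨u, v⟩
    change x⁻¹ ^ (u + v) * q ^ (u + v) ^ 2 * (y⁻¹ ^ (u - v) * q ^ (u - v) ^ 2) = _
    have e : q ^ (u + v) ^ 2 * q ^ (u - v) ^ 2 = q ^ (2 * u ^ 2) * q ^ (2 * v ^ 2) := by
      rw [← zpow_add₀ hq0, ← zpow_add₀ hq0]; congr 1; ring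
    have hxu : x ^ u ≠ 0 := zpow_ne_zero _ hx
    have hxv : x ^ v ≠ 0 := zpow_ne_zero _ hx
    have hyu : y ^ u ≠ 0 := zpow_ne_zero _ hy
    have hyv : y ^ v ≠ 0 := zpow_ne_zero _ hy
    rw [mul_mul_mul_comm, e]
    simp only [hpow, inv_zpow, mul_zpow, div_zpow, zpow_add₀ hx, zpow_sub₀ hy]
    field_simp
  · refine hB.congr_fun ?_
    rintro ⟨u, v⟩
    change x⁻¹ ^ (u + v + 1) * q ^ (u + v + 1) ^ 2 * (y⁻¹ ^ (u - v) * q ^ (u - v) ^ 2) = _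
    have e : q ^ (u + v + 1) ^ 2 * q ^ (u - v) ^ 2 =
        q * (q ^ (2 * u) * q ^ (2 * u ^ 2)) * (q ^ (2 * v) * q ^ (2 * v ^ 2)) := by
      rw [← zpow_add₀ hq0, ← zpow_add₀ hq0, ← zpow_add₀ hq0, ← zpow_one_add₀ hq0,
        ← zpow_add₀ hq0]
      congr 1; ring
    have hxu : x ^ u ≠ 0 := zpow_ne_zero _ hx
    have hxv : x ^ v ≠ 0 := zpow_ne_zero _ hx
    have hyu : y ^ u ≠ 0 := zpow_ne_zero _ hy
    have hyv : y ^ v ≠ 0 := zpow_ne_zero _ hy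
    rw [mul_mul_mul_comm, e]
    simp only [hpow, inv_zpow, mul_zpow, div_zpow, zpow_add₀ hx, zpow_sub₀ hy, zpow_one]
    field_simp

/-! ### A Bailey pair and its conjugate -/

/-- A Bailey pair relative to `1`: the sum of
`(-1) ^ s q ^ (3 s ^ 2 + s) / ((q; q)_{n - 2s} (q; q)_{n + 2s})` over `s ∈ ℤ` is
`1 / ((q; q ^ 2)_n (q; q)_n)`. The summand is written with `(-q) ^ s (q ^ 3) ^ (s ^ 2)`, which is
the summand of a theta series. -/
theorem bailey_pair {q : ℂ} (hq0 : q ≠ 0) (hq : ‖q‖ < 1) (n : ℕ) :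
    qPoch q (q ^ 2) n * qPoch q q n * ∑' s : ℤ, (-q) ^ s * (q ^ 3) ^ (s ^ 2) *
      (invPoch q (n - 2 * s) * invPoch q (n + 2 * s)) = 1 := by
  have hq3 : ‖q ^ 3‖ < 1 := norm_pow_lt_one hq three_ne_zero
  have hq30 : q ^ 3 ≠ 0 := pow_ne_zero _ hq0
  have hnq0 : -q ≠ 0 := neg_ne_zero.2 hq0
  induction n with
  | zero =>
    rw [tsum_eq_single 0]
    · simp
    · intro s hs
      rcases lt_or_gt_of_ne hs with h | h
      · rw [invPoch_of_neg (m := ((0 : ℕ) : ℤ) + 2 * s) _ (by lia)]; simp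
      · rw [invPoch_of_neg (m := ((0 : ℕ) : ℤ) - 2 * s) _ (by lia)]; simp
  | succ n ih =>
    set T : ℕ → ℤ → ℂ := fun n s => (-q) ^ s * (q ^ 3) ^ (s ^ 2) *
      (invPoch q (n - 2 * s) * invPoch q (n + 2 * s)) with hT
    set T' : ℕ → ℤ → ℂ := fun n s => ((-q)⁻¹) ^ s * (q ^ 3) ^ (s ^ 2) *
      (invPoch q (n - 2 * s) * invPoch q (n + 2 * s)) with hT'
    set G : ℤ → ℂ := fun s => ((-q ^ 3)⁻¹) ^ s * (q ^ 3) ^ (s ^ 2) *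
      (invPoch q (n + 1 - 2 * s) * invPoch q (n - 1 + 2 * s)) with hG
    have hs : ∀ n, Summable (T n) := fun n => summable_theta_mul_invPoch hnq0 hq30 hq3 hq _ _
    have hs' : ∀ n, Summable (T' n) := fun n =>
      summable_theta_mul_invPoch (inv_ne_zero hnq0) hq30 hq3 hq _ _
    have hsG : Summable G :=
      summable_theta_mul_invPoch (inv_ne_zero (neg_ne_zero.2 hq30)) hq30 hq3 hq _ _
    have hTT' : ∀ n, ∑' s, T' n s = ∑' s, T n s := fun n => by
      rw [← (Equiv.neg ℤ).tsum_eq]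
      refine tsum_congr fun s => ?_
      simp only [hT, hT', Equiv.neg_apply, inv_zpow', neg_neg, neg_sq, mul_neg, sub_neg_eq_add]
      rw [← sub_eq_add_neg]
      ring
    -- `T` and its reflection `T'` have the same sum; `T + T'` has the telescoping certificate `G`.
    have key : ∀ s, (1 - q ^ (2 * n + 1)) * (1 - q ^ (n + 1)) * (T (n + 1) s + T' (n + 1) s) =
        (T n s + T' n s) + -q ^ (n + 1) * (G (s + 1) - G s) := by
      intro s
      simp only [hT, hT', hG]
      rw [show (n : ℤ) - 2 * s = (((n + 1 : ℕ) : ℤ) - 2 * s) - 1 by push_cast; ring,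
        show (n : ℤ) + 2 * s = (((n + 1 : ℕ) : ℤ) + 2 * s) - 1 by push_cast; ring,
        show (n : ℤ) + 1 - 2 * (s + 1) = (((n + 1 : ℕ) : ℤ) - 2 * s) - 1 - 1 by push_cast; ring,
        show (n : ℤ) - 1 + 2 * (s + 1) = (((n + 1 : ℕ) : ℤ) + 2 * s) by push_cast; ring,
        show (n : ℤ) + 1 - 2 * s = (((n + 1 : ℕ) : ℤ) - 2 * s) by push_cast; ring,
        show (n : ℤ) - 1 + 2 * s = (((n + 1 : ℕ) : ℤ) + 2 * s) - 1 - 1 by push_cast; ring]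
      simp only [invPoch_sub_one hq]
      generalize invPoch q (((n + 1 : ℕ) : ℤ) - 2 * s) = A
      generalize invPoch q (((n + 1 : ℕ) : ℤ) + 2 * s) = B
      rw [show (s + 1) ^ 2 = s ^ 2 + s + s + 1 by ring, show 2 * s = s + s by ring]
      have h3 : ∀ m : ℤ, (q ^ 3) ^ m = (q ^ m) ^ 3 := fun m => by
        rw [← zpow_natCast, ← zpow_natCast, ← zpow_mul, ← zpow_mul, mul_comm]
      have hneg : ∀ m : ℤ, (-q) ^ m = (-1) ^ m * q ^ m := fun m => by rw [← mul_zpow, neg_one_mul]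
      have hneg3 : ∀ m : ℤ, (-q ^ 3) ^ m = (-1) ^ m * (q ^ m) ^ 3 := fun m => by
        rw [← h3, ← mul_zpow, neg_one_mul]
      have hm1 : (-1 : ℂ) ^ s * (-1) ^ s = 1 := by rw [← mul_zpow]; simp
      have hm10 : (-1 : ℂ) ^ s ≠ 0 := left_ne_zero_of_mul_eq_one hm1
      have hinv : ((-1 : ℂ) ^ s)⁻¹ = (-1) ^ s := inv_eq_of_mul_eq_one_right hm1
      simp only [hneg, hneg3, h3, inv_zpow, zpow_add₀ hq0, zpow_sub₀ hq0,
        zpow_add₀ (neg_ne_zero.2 (one_ne_zero' ℂ)), Nat.cast_add, Nat.cast_one, zpow_natCast,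
        zpow_one, mul_inv, hinv]
      have hX : q ^ s ≠ 0 := zpow_ne_zero _ hq0
      have eY : q ^ (2 * n + 1) = q * (q ^ n) ^ 2 := by ring
      have eY1 : q ^ (n + 1) = q * q ^ n := by ring
      rw [eY, eY1]
      generalize q ^ s = X at *
      generalize q ^ n = Y at *
      generalize q ^ s ^ 2 = W at *
      generalize (-1 : ℂ) ^ s = Z at *
      field_simp
      ring
    have hsum := tsum_congr (L := .unconditional ℤ) key
    have hG1 := ((Equiv.addRight (1 : ℤ)).summable_iff (f := G)).2 hsG
    have tG1 := (Equiv.addRight (1 : ℤ)).tsum_eq G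
    simp only [Function.comp_def, Equiv.coe_addRight] at hG1 tG1
    rw [tsum_mul_left, Summable.tsum_add (hs _) (hs' _),
      Summable.tsum_add ((hs _).add (hs' _)) ((hG1.sub hsG).mul_left _),
      Summable.tsum_add (hs _) (hs' _), tsum_mul_left, Summable.tsum_sub hG1 hsG, tG1, hTT',
      hTT', sub_self, mul_zero, add_zero] at hsum
    have e : q * (q ^ 2) ^ n = q ^ (2 * n + 1) := by ring
    rw [qPoch_succ, qPoch_succ, e, ← pow_succ']
    linear_combination ih + (1 / 2) * qPoch q (q ^ 2) n * qPoch q q n * hsum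

/-- The limit `a → ∞` of the `q`-Gauss sum `₂φ₁(a, b; c; c / ab)` at `c = q ^ (M + 1)`, divided by
`(q; q)_M`. The contiguous relation that raises `M` by one telescopes, and iterating it reduces the
sum to its limit for `M → ∞`. -/
theorem q_gauss_sum {b q : ℂ} (hb : b ≠ 0) (hq0 : q ≠ 0) (hq : ‖q‖ < 1) (M : ℕ) :
    HasSum (fun m : ℕ => qPoch b q m * (-b⁻¹) ^ m * q ^ (m.choose 2 + (M + 1) * m) *
        (invPoch q m * invPoch q (M + m : ℕ)))
      (qPochInf (q ^ (M + 1) / b) q / qPochInf q q) := by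
  obtain ⟨K, hK0, hK⟩ := exists_norm_invPoch_le hq
  obtain ⟨L, hL0, hL⟩ := exists_norm_qPoch_le b hq
  set t : ℕ → ℕ → ℂ := fun M m => qPoch b q m * (-b⁻¹) ^ m * q ^ (m.choose 2 + (M + 1) * m) *
        (invPoch q m * invPoch q (M + m : ℕ)) with ht
  set bd : ℕ → ℝ := fun m => L * ‖(-b⁻¹) ^ m * q ^ (m.choose 2)‖ * (K * K) with hbd
  have hbds : Summable bd := by
    refine Summable.mul_right _ (Summable.mul_left _ ?_)
    refine summable_of_ratio_test_tendsto_lt_one (l := 0) one_pos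
      (Eventually.of_forall fun k => norm_ne_zero_iff.2
        (mul_ne_zero (pow_ne_zero _ (neg_ne_zero.2 (inv_ne_zero hb))) (pow_ne_zero _ hq0))) ?_
    have h := (tendsto_pow_atTop_nhds_zero_of_lt_one (norm_nonneg q) hq).const_mul ‖-b⁻¹‖
    rw [mul_zero] at h
    refine h.congr fun k => ?_
    rw [norm_norm, norm_norm, ← norm_div, ← norm_pow, ← norm_mul]
    congr 1
    have : (-b⁻¹) ^ k ≠ 0 := pow_ne_zero _ (neg_ne_zero.2 (inv_ne_zero hb))
    have : q ^ k.choose 2 ≠ 0 := pow_ne_zero _ hq0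
    rw [eq_div_iff (by positivity), Nat.choose_succ_succ' k 1, Nat.choose_one_right]
    ring
  have htbd : ∀ M m, ‖t M m‖ ≤ bd m * ‖q‖ ^ ((M + 1) * m) := fun M m => by
    rw [show t M m = qPoch b q m * ((-b⁻¹) ^ m * q ^ (m.choose 2)) *
        (invPoch q m * invPoch q (M + m : ℕ)) * q ^ ((M + 1) * m) by
      simp only [ht, pow_add]; ring, norm_mul, norm_pow q, norm_mul, norm_mul (invPoch _ _),
      norm_mul (qPoch _ _ _)]
    refine mul_le_mul_of_nonneg_right ?_ (by positivity)
    simp only [hbd]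
    gcongr
    exacts [hL m, hK _, hK _]
  have hbd0 : ∀ m, 0 ≤ bd m := fun m => by positivity
  have htbd' : ∀ M m, ‖t M m‖ ≤ bd m := fun M m => (htbd M m).trans
    (mul_le_of_le_one_right (hbd0 m) (pow_le_one₀ (norm_nonneg q) hq.le))
  have hts : ∀ M, Summable (t M) := fun M => .of_norm_bounded hbds (htbd' M)
  have hrec : ∀ M, ∑' m, t M m = (1 - q ^ (M + 1) / b) * ∑' m, t (M + 1) m := by
    intro M
    set g : ℕ → ℂ := fun m => t M m * (1 - q ^ m) with hg
    have key : ∀ m, t M m - (1 - q ^ (M + 1) / b) * t (M + 1) m = g m - g (m + 1) := by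
      intro m
      have e1 : invPoch q m = (1 - q ^ (m + 1)) * invPoch q (m + 1 : ℕ) := by
        have := invPoch_sub_one hq (m + 1 : ℕ)
        rw [zpow_natCast] at this
        rw [← this]; push_cast; ring_nf
      have e2 : invPoch q (M + m : ℕ) = (1 - q ^ (M + m + 1)) * invPoch q (M + m + 1 : ℕ) := by
        have := invPoch_sub_one hq (M + m + 1 : ℕ)
        rw [zpow_natCast] at this
        rw [← this]; push_cast; ring_nf
      simp only [hg, ht]
      rw [show M + 1 + m = M + m + 1 by ring, show M + (m + 1) = M + m + 1 by ring, e2, e1,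
        qPoch_succ, Nat.choose_succ_succ' m 1, Nat.choose_one_right]
      generalize invPoch q (M + m + 1 : ℕ) = A
      generalize invPoch q (m + 1 : ℕ) = B
      generalize qPoch b q m = C
      generalize m.choose 2 = c
      rw [show m + c + (M + 1) * (m + 1) = c + (M + 1) * m + (m + M + 1) by ring,
        show c + (M + 1 + 1) * m = c + (M + 1) * m + m by ring, pow_add q (c + (M + 1) * m),
        pow_add q (c + (M + 1) * m)]
      generalize q ^ (c + (M + 1) * m) = D
      rw [pow_succ (-b⁻¹)]
      generalize (-b⁻¹) ^ m = F
      field_simp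
      ring
    have hgs : Summable g := by
      have h1 : Summable fun m => t M m * q ^ m := by
        refine .of_norm_bounded hbds fun m => ?_
        rw [norm_mul, norm_pow]
        exact (mul_le_of_le_one_right (norm_nonneg _) (pow_le_one₀ (norm_nonneg q) hq.le)).trans
          (htbd' M m)
      refine ((hts M).sub h1).congr fun m => ?_
      simp only [hg]; ring
    have hsum := tsum_congr (L := .unconditional ℕ) key
    rw [Summable.tsum_sub (hts _) ((hts _).mul_left _), tsum_mul_left,
      Summable.tsum_sub hgs ((summable_nat_add_iff 1).2 hgs), hgs.tsum_eq_zero_add] at hsum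
    have hg0 : g 0 = 0 := by simp [hg]
    rw [hg0] at hsum
    linear_combination hsum
  have hiter : ∀ N, ∑' m, t M m = qPoch (q ^ (M + 1) / b) q N * ∑' m, t (M + N) m := by
    intro N
    induction N with
    | zero => simp
    | succ N ih =>
      rw [ih, hrec, qPoch_succ, show M + (N + 1) = M + N + 1 by ring]
      ring
  have hlim : Tendsto (fun N => ∑' m, t (M + N) m) atTop
      (𝓝 (∑' m, if m = 0 then (qPochInf q q)⁻¹ else 0)) := by
    refine tendsto_tsum_of_dominated_convergence hbds (fun m => ?_)
      (Eventually.of_forall fun N m => htbd' _ m)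
    have hMN : Tendsto (fun N : ℕ => ((M + N : ℕ) : ℤ)) atTop atTop :=
      tendsto_natCast_atTop_atTop.comp (tendsto_add_atTop_nat M |>.congr fun N => add_comm _ _)
    rcases eq_or_ne m 0 with rfl | hm
    · simpa [ht, Function.comp_def] using (tendsto_invPoch hq).comp hMN
    · rw [if_neg hm]
      have h0 : Tendsto (fun N : ℕ => bd m * ‖q‖ ^ N) atTop (𝓝 (bd m * 0)) :=
        (tendsto_pow_atTop_nhds_zero_of_lt_one (norm_nonneg q) hq).const_mul _
      rw [mul_zero] at h0
      refine squeeze_zero_norm (fun N => (htbd _ m).trans ?_) h0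
      refine mul_le_mul_of_nonneg_left (pow_le_pow_of_le_one (norm_nonneg q) hq.le ?_) (hbd0 m)
      nlinarith [Nat.one_le_iff_ne_zero.2 hm]
  rw [tsum_ite_eq] at hlim
  have h2 := (tendsto_qPoch (q ^ (M + 1) / b) hq).mul hlim
  simp only [← hiter] at h2
  rw [div_eq_mul_inv, ← tendsto_nhds_unique tendsto_const_nhds h2]
  exact (hts M).hasSum

/-- The conjugate Bailey pair that belongs to the parameters `ρ₁ = -1`, `ρ₂ → ∞` of Bailey's lemma.
The terms with `n < r` vanish, and the others form the sum of `q_gauss_sum` with `b = -q ^ r` and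
`M = 2r`. -/
theorem conjugate_bailey_pair_nat {q : ℂ} (hq0 : q ≠ 0) (hq : ‖q‖ < 1) (r : ℕ) :
    HasSum (fun n : ℕ => qPoch (-1) q n * q ^ ((n + 1).choose 2) *
        (invPoch q (n - r) * invPoch q (n + r)))
      (2 * q ^ ((r + 1).choose 2) / (1 + q ^ r) * (qPochInf (-q) q / qPochInf q q)) := by
  have hqr : q ^ r ≠ 0 := pow_ne_zero _ hq0
  have h1 : 1 + q ^ r ≠ 0 := by
    rcases eq_or_ne r 0 with rfl | hr
    · norm_num
    · intro h
      have := norm_pow_lt_one hq hr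
      rw [eq_neg_of_add_eq_zero_right h] at this
      simp at this
  rw [← (add_left_injective r).hasSum_iff]
  · have h := (q_gauss_sum (b := -q ^ r) (neg_ne_zero.2 hqr) hq0 hq (2 * r)).mul_left
      (qPoch (-1) q r * q ^ ((r + 1).choose 2))
    have e1 : qPoch (-1) q r * (1 + q ^ r) = 2 * qPoch (-q) q r := by
      have h2 := qPoch_succ (-1) q r
      rw [add_comm, qPoch_add] at h2
      simp [qPoch_succ] at h2
      linear_combination -h2
    have e2 : q ^ (2 * r + 1) / -q ^ r = -q * q ^ r := by field_simp; ring
    have e3 := qPochInf_eq_mul (-q) hq r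
    rw [e2] at h
    convert! h using 1
    · ext m
      simp only [Function.comp_def]
      rw [add_comm m r, qPoch_add]
      have c1 : (r + m + 1).choose 2 + r * m =
          (r + 1).choose 2 + (m.choose 2 + (2 * r + 1) * m) := by
        clear h
        induction m with
        | zero => simp
        | succ m ih =>
          have h3 := Nat.choose_succ_succ' (r + m + 1) 1
          have h4 := Nat.choose_succ_succ' m 1
          rw [Nat.choose_one_right] at h3 h4
          simp only [Nat.reduceAdd] at h3 h4
          rw [← add_assoc, h3, h4]
          linear_combination ih
      have c2 : q ^ ((r + m + 1).choose 2) * (q ^ r) ^ m =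
          q ^ ((r + 1).choose 2) * q ^ (m.choose 2 + (2 * r + 1) * m) := by
        rw [← pow_mul, ← pow_add, c1, pow_add]
      rw [show ((r + m : ℕ) : ℤ) - r = m by push_cast; ring,
        show ((r + m : ℕ) : ℤ) + r = (2 * r + m : ℕ) by push_cast; ring,
        show -(-q ^ r)⁻¹ = (q ^ r)⁻¹ by rw [inv_neg, neg_neg], inv_pow, neg_one_mul]
      have : (q ^ r) ^ m ≠ 0 := pow_ne_zero _ hqr
      field_simp
      linear_combination (qPoch (-1) q r * qPoch (-q ^ r) q m * invPoch q m *
        invPoch q (2 * r + m : ℕ)) * c2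
    · rw [e3]
      have := qPochInf_ne_zero hq hq
      field_simp
      linear_combination -qPochInf (-(q ^ r * q)) q * e1
  · intro n hn
    have : n < r := by
      by_contra h
      exact hn ⟨n - r, by simp; lia⟩
    rw [invPoch_of_neg (m := (n : ℤ) - r) q (by lia)]
    simp

theorem one_add_zpow_ne_zero {q : ℂ} (hq : ‖q‖ < 1) (m : ℤ) : 1 + q ^ m ≠ 0 := by
  intro h
  have h1 : ‖q‖ ^ m = 1 := by
    rw [← norm_zpow, eq_neg_of_add_eq_zero_right h, norm_neg, norm_one]
  rw [zpow_eq_one_iff_right₀ (norm_nonneg q) hq.ne] at h1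
  norm_num [h1] at h

/-- The conjugate Bailey pair at an even index `2s` of either sign. The right-hand side is invariant
under `s ↦ -s`, like the left-hand side. -/
theorem conjugate_bailey_pair {q : ℂ} (hq0 : q ≠ 0) (hq : ‖q‖ < 1) (s : ℤ) :
    HasSum (fun n : ℕ => qPoch (-1) q n * q ^ ((n + 1).choose 2) *
        (invPoch q (n - 2 * s) * invPoch q (n + 2 * s)))
      (2 * q ^ (s * (2 * s + 1)) / (1 + q ^ (2 * s)) * (qPochInf (-q) q / qPochInf q q)) := by
  have hchoose : ∀ t : ℕ, (2 * t + 1).choose 2 = t * (2 * t + 1) := fun t => by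
    rw [Nat.choose_two_right, Nat.add_sub_cancel]
    refine Nat.div_eq_of_eq_mul_left two_pos (by ring)
  rcases Int.eq_nat_or_neg s with ⟨t, rfl | rfl⟩
  · have h := conjugate_bailey_pair_nat hq0 hq (2 * t)
    rw [hchoose] at h
    exact_mod_cast h
  · have h := conjugate_bailey_pair_nat hq0 hq (2 * t)
    rw [hchoose] at h
    convert! h using 1
    · ext n
      push_cast
      rw [mul_neg, sub_neg_eq_add, ← sub_eq_add_neg, mul_comm (invPoch _ _)]
    · have h2 : q ^ (-(t : ℤ) * (2 * -(t : ℤ) + 1)) = q ^ (t * (2 * t + 1)) / q ^ (2 * t) := by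
        rw [← zpow_natCast, ← zpow_natCast, ← zpow_sub₀ hq0]
        congr 1; push_cast; ring
      have h3 : q ^ (2 * -(t : ℤ)) = (q ^ (2 * t))⁻¹ := by
        rw [← zpow_natCast, ← zpow_neg]
        congr 1; push_cast; ring
      have h4 := one_add_zpow_ne_zero hq (2 * -(t : ℤ))
      have h5 := one_add_zpow_ne_zero hq (2 * t : ℕ)
      rw [h3] at h4
      rw [zpow_natCast] at h5
      have h6 : q ^ (2 * t) ≠ 0 := pow_ne_zero _ hq0
      rw [h2, h3]
      congr 1
      generalize q ^ (2 * t) = X at *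
      have h7 : X + 1 ≠ 0 := by rwa [add_comm] at h5
      field_simp
      ring

theorem summable_qPoch_mul_pow_choose (a : ℂ) {q : ℂ} (hq : ‖q‖ < 1) :
    Summable fun n : ℕ => ‖qPoch a q n * q ^ ((n + 1).choose 2)‖ := by
  obtain ⟨L, hL0, hL⟩ := exists_norm_qPoch_le a hq
  refine .of_nonneg_of_le (fun _ => norm_nonneg _) (fun n => ?_)
    ((summable_geometric_of_lt_one (norm_nonneg q) hq).mul_left L)
  rw [norm_mul, norm_pow]
  refine mul_le_mul (hL n) (pow_le_pow_of_le_one (norm_nonneg q) hq.le ?_) (by positivity) hL0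
  rw [Nat.choose_succ_succ' n 1, Nat.choose_one_right]
  exact Nat.le_add_right _ _

/-- Bailey's lemma for the pair `bailey_pair`: exchange the order of summation in the double series
over `n` and `s`, and symmetrize the resulting series over `s`. -/
theorem hasSum_bailey {q : ℂ} (hq0 : q ≠ 0) (hq : ‖q‖ < 1) :
    HasSum (fun n : ℕ => qPoch (-1) q n * q ^ ((n + 1).choose 2) /
        (qPoch q (q ^ 2) n * qPoch q q n))
      (qPochInf (-q) q / qPochInf q q * thetaSeries (-1) (q ^ 5)) := by
  obtain ⟨K, hK0, hK⟩ := exists_norm_invPoch_le hq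
  have hq3 : ‖q ^ 3‖ < 1 := norm_pow_lt_one hq three_ne_zero
  have hq30 : q ^ 3 ≠ 0 := pow_ne_zero _ hq0
  have hnq0 : -q ≠ 0 := neg_ne_zero.2 hq0
  set C := qPochInf (-q) q / qPochInf q q with hC
  set A : ℕ → ℂ := fun n => qPoch (-1) q n * q ^ ((n + 1).choose 2) with hA
  set c : ℤ → ℂ := fun s => (-q) ^ s * (q ^ 3) ^ (s ^ 2) with hc
  set I : ℕ → ℤ → ℂ := fun n s => invPoch q (n - 2 * s) * invPoch q (n + 2 * s) with hI
  have hF : Summable fun p : ℕ × ℤ => A p.1 * c p.2 * I p.1 p.2 := by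
    refine .of_norm_bounded (((summable_qPoch_mul_pow_choose (-1) hq).mul_of_nonneg
      (summable_norm_theta hnq0 hq30 hq3) (fun _ => norm_nonneg _)
      (fun _ => norm_nonneg _)).mul_right (K * K)) fun p => ?_
    rw [norm_mul, norm_mul (A _), norm_mul (invPoch _ _)]
    refine mul_le_mul_of_nonneg_left ?_ (by positivity)
    gcongr <;> exact hK _
  have hrow : ∀ n, HasSum (fun s => A n * c s * I n s)
      (A n / (qPoch q (q ^ 2) n * qPoch q q n)) := by
    intro n
    have h := (summable_theta_mul_invPoch hnq0 hq30 hq3 hq (fun s => n - 2 * s)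
      (fun s => n + 2 * s)).hasSum.mul_left (A n)
    have hb := bailey_pair hq0 hq n
    rw [div_eq_mul_inv, inv_eq_of_mul_eq_one_right hb]
    simpa only [hc, hI, mul_assoc] using h
  have hcol : ∀ s, HasSum (fun n => A n * c s * I n s)
      (c s * (2 * q ^ (s * (2 * s + 1)) / (1 + q ^ (2 * s)) * C)) := by
    intro s
    refine ((conjugate_bailey_pair hq0 hq s).mul_left (c s)).congr_fun fun n => ?_
    simp only [hA, hI]; ring
  have h1 := hF.hasSum.prod_fiberwise hrow
  have h2 := ((Equiv.prodComm ℤ ℕ).hasSum_iff.2 hF.hasSum).prod_fiberwise hcol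
  set S := ∑' p : ℕ × ℤ, A p.1 * c p.2 * I p.1 p.2
  -- The factor `1 / (1 + q ^ (2s))` disappears on adding the series to its reflection, since
  -- `X / (1 + X) + X⁻¹ / (1 + X⁻¹) = 1`.
  have h3 := (Equiv.neg ℤ).hasSum_iff.2 h2
  have h4 := h2.add h3
  have h5 : HasSum (fun s : ℤ => (2 * C) * ((-1) ^ s * (q ^ 5) ^ (s ^ 2))) (S + S) := by
    refine h4.congr_fun fun s => ?_
    simp only [hc, Function.comp_def, Equiv.neg_apply]
    have e1 : q ^ (s * (2 * s + 1)) = q ^ (2 * s ^ 2) * q ^ s := by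
      rw [← zpow_add₀ hq0]; congr 1; ring
    have e2 : q ^ (-s * (2 * -s + 1)) = q ^ (2 * s ^ 2) * (q ^ s)⁻¹ := by
      rw [← zpow_neg, ← zpow_add₀ hq0]; congr 1; ring
    have e3 : q ^ (2 * s) = q ^ s * q ^ s := by
      rw [← zpow_add₀ hq0]; congr 1; ring
    have e4 : q ^ (2 * -s) = (q ^ s * q ^ s)⁻¹ := by
      rw [← e3, ← zpow_neg]; congr 1; ring
    have e5 : (q ^ 5) ^ s ^ 2 = (q ^ 3) ^ s ^ 2 * q ^ (2 * s ^ 2) := by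
      rw [show q ^ 5 = q ^ 3 * q ^ 2 by ring, mul_zpow]
      congr 1
      rw [← zpow_natCast, ← zpow_mul]; rfl
    have hm1 : (-1 : ℂ) ^ s * (-1) ^ s = 1 := by rw [← mul_zpow]; simp
    have hinv : ((-1 : ℂ) ^ s)⁻¹ = (-1) ^ s := inv_eq_of_mul_eq_one_right hm1
    have hneg : ∀ m : ℤ, (-q) ^ m = (-1) ^ m * q ^ m := fun m => by rw [← mul_zpow, neg_one_mul]
    have d1 := one_add_zpow_ne_zero hq (2 * s)
    have d2 := one_add_zpow_ne_zero hq (2 * -s)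
    rw [e3] at d1
    rw [e4] at d2
    rw [neg_sq, e1, e2, e3, e4, e5, hneg, hneg, zpow_neg, zpow_neg, hinv]
    have hX : q ^ s ≠ 0 := zpow_ne_zero _ hq0
    generalize q ^ s = X at *
    have d3 : 1 + X ^ 2 ≠ 0 := by rwa [pow_two]
    have d4 : X ^ 2 + 1 ≠ 0 := by rwa [add_comm]
    field_simp
    ring
  have h6 := (summable_norm_theta (neg_ne_zero.2 (one_ne_zero' ℂ)) (pow_ne_zero 5 hq0)
    (norm_pow_lt_one hq (by norm_num))).of_norm.hasSum.mul_left (2 * C)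
  have h7 : S = C * thetaSeries (-1) (q ^ 5) := by
    have := h5.unique h6
    rw [thetaSeries]
    linear_combination this / 2
  rwa [← h7]

/-! ### Theta functions of nome `q ^ 5` -/

/-- Splitting the factors of `(a; q)_∞` by their residue modulo `m`. -/
theorem qPochInf_dissection (a : ℂ) {q : ℂ} (hq : ‖q‖ < 1) {m : ℕ} (hm : m ≠ 0) :
    qPochInf a q = ∏ j ∈ Finset.range m, qPochInf (a * q ^ j) (q ^ m) := by
  have hfin : ∀ n, qPoch a q (m * n) =
      ∏ j ∈ Finset.range m, qPoch (a * q ^ j) (q ^ m) n := by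
    intro n
    induction n with
    | zero => simp
    | succ n ih =>
      rw [Nat.mul_succ, qPoch_add, ih]
      simp only [qPoch_succ, Finset.prod_mul_distrib]
      congr 1
      refine Finset.prod_congr rfl fun j _ => ?_
      ring
  have h1 : Tendsto (fun n => qPoch a q (m * n)) atTop (𝓝 (qPochInf a q)) :=
    (tendsto_qPoch a hq).comp (tendsto_id.const_mul_atTop' (Nat.pos_of_ne_zero hm))
  simp only [hfin] at h1
  exact tendsto_nhds_unique h1
    (tendsto_finsetProd _ fun j _ => tendsto_qPoch _ (norm_pow_lt_one hq hm))

theorem qPochInf_mul_qPochInf_neg (a : ℂ) {q : ℂ} (hq : ‖q‖ < 1) :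
    qPochInf a q * qPochInf (-a) q = qPochInf (a ^ 2) (q ^ 2) := by
  refine tendsto_nhds_unique ((tendsto_qPoch a hq).mul (tendsto_qPoch (-a) hq)) ?_
  refine (tendsto_qPoch (a ^ 2) (norm_pow_lt_one hq two_ne_zero)).congr fun n => ?_
  rw [qPoch, qPoch, qPoch, ← Finset.prod_mul_distrib]
  exact Finset.prod_congr rfl fun k _ => by ring

/-- Euler's identity `1 / (q; q ^ 2)_∞ = (-q; q)_∞`, which says that partitions into odd parts and
partitions into distinct parts are equinumerous. -/
theorem qPochInf_odd_mul_qPochInf_neg {q : ℂ} (hq : ‖q‖ < 1) :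
    qPochInf q (q ^ 2) * qPochInf (-q) q = 1 := by
  have h1 := qPochInf_dissection q hq two_ne_zero
  have h2 := qPochInf_mul_qPochInf_neg q hq
  have hq2 := norm_pow_lt_one hq two_ne_zero
  rw [h1] at h2
  simp only [Finset.prod_range_succ, Finset.prod_range_zero, pow_zero, pow_one, one_mul, mul_one,
    ← pow_two] at h2
  have h3 : qPochInf (q ^ 2) (q ^ 2) ≠ 0 := qPochInf_ne_zero hq2 hq2
  refine mul_left_cancel₀ h3 ?_
  linear_combination h2

/-- A case of Weierstrass's three-term relation for theta functions. Every pairwise product below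
expands by `thetaSeries_mul` into theta series of nome `q ^ 10`, and in these the identity is
polynomial. -/
theorem theta_identity {q : ℂ} (hq0 : q ≠ 0) (hq : ‖q‖ < 1) :
    thetaSeries q (q ^ 5) * thetaSeries (q ^ 2) (q ^ 5) * thetaSeries (q ^ 3) (q ^ 5) *
        thetaSeries (q ^ 4) (q ^ 5) -
      thetaSeries (-q) (q ^ 5) * thetaSeries (-q ^ 2) (q ^ 5) * thetaSeries (-q ^ 3) (q ^ 5) *
        thetaSeries (-q ^ 4) (q ^ 5) =
      q * (thetaSeries (q ^ 5) (q ^ 5) * thetaSeries 1 (q ^ 5) * thetaSeries (q ^ 4) (q ^ 5) *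
        thetaSeries (q ^ 3) (q ^ 5)) := by
  have hq5 := norm_pow_lt_one hq (m := 5) (by norm_num)
  have h : ∀ {x y : ℂ}, x ≠ 0 → y ≠ 0 → _ := fun {x y} hx hy =>
    thetaSeries_mul (x := x) (y := y) hx hy (pow_ne_zero 5 hq0) hq5
  have hp : ∀ k : ℕ, q ^ k ≠ 0 := fun k => pow_ne_zero k hq0
  have hn : ∀ k : ℕ, -q ^ k ≠ 0 := fun k => neg_ne_zero.2 (hp k)
  have h41 := h (hp 4) hq0
  have h32 := h (hp 3) (hp 2)
  have h41' := h (hn 4) (neg_ne_zero.2 hq0)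
  have h32' := h (hn 3) (hn 2)
  have h43 := h (hp 4) (hp 3)
  have h50 := h (hp 5) one_ne_zero
  rw [show q ^ 4 * q = q ^ 5 by ring, show q ^ 4 / q = q ^ 3 by field_simp,
    show (q ^ 5) ^ 2 / q ^ 5 = q ^ 5 by field_simp,
    show (q ^ 5) ^ 2 * q / q ^ 4 = q ^ 7 by field_simp, show q ^ 5 / q ^ 4 = q by field_simp,
    show (q ^ 5) ^ 2 = q ^ 10 by ring] at h41
  rw [show q ^ 3 * q ^ 2 = q ^ 5 by ring, show q ^ 3 / q ^ 2 = q by field_simp,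
    show (q ^ 5) ^ 2 / q ^ 5 = q ^ 5 by field_simp,
    show (q ^ 5) ^ 2 * q ^ 2 / q ^ 3 = q ^ 9 by field_simp,
    show q ^ 5 / q ^ 3 = q ^ 2 by field_simp, show (q ^ 5) ^ 2 = q ^ 10 by ring] at h32
  rw [show -q ^ 4 * -q = q ^ 5 by ring, show -q ^ 4 / -q = q ^ 3 by field_simp,
    show (q ^ 5) ^ 2 / q ^ 5 = q ^ 5 by field_simp,
    show (q ^ 5) ^ 2 * -q / -q ^ 4 = q ^ 7 by field_simp, show q ^ 5 / -q ^ 4 = -q by field_simp,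
    show (q ^ 5) ^ 2 = q ^ 10 by ring] at h41'
  rw [show -q ^ 3 * -q ^ 2 = q ^ 5 by ring, show -q ^ 3 / -q ^ 2 = q by field_simp,
    show (q ^ 5) ^ 2 / q ^ 5 = q ^ 5 by field_simp,
    show (q ^ 5) ^ 2 * -q ^ 2 / -q ^ 3 = q ^ 9 by field_simp,
    show q ^ 5 / -q ^ 3 = -q ^ 2 by field_simp, show (q ^ 5) ^ 2 = q ^ 10 by ring] at h32'
  rw [show q ^ 4 * q ^ 3 = q ^ 7 by ring, show q ^ 4 / q ^ 3 = q by field_simp,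
    show (q ^ 5) ^ 2 / q ^ 7 = q ^ 3 by field_simp,
    show (q ^ 5) ^ 2 * q ^ 3 / q ^ 4 = q ^ 9 by field_simp,
    show q ^ 5 / q ^ 4 = q by field_simp, show (q ^ 5) ^ 2 = q ^ 10 by ring] at h43
  rw [mul_one, div_one, show (q ^ 5) ^ 2 / q ^ 5 = q ^ 5 by field_simp,
    show (q ^ 5) ^ 2 * 1 / q ^ 5 = q ^ 5 by field_simp,
    show q ^ 5 / q ^ 5 = 1 by field_simp, show (q ^ 5) ^ 2 = q ^ 10 by ring] at h50
  linear_combination (thetaSeries (q ^ 3) (q ^ 5) * thetaSeries (q ^ 2) (q ^ 5)) * h41 +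
    (thetaSeries (q ^ 5) (q ^ 10) * thetaSeries (q ^ 3) (q ^ 10) +
      q * (thetaSeries (q ^ 5) (q ^ 10) * thetaSeries (q ^ 7) (q ^ 10))) * h32 -
    (thetaSeries (-q ^ 3) (q ^ 5) * thetaSeries (-q ^ 2) (q ^ 5)) * h41' -
    (thetaSeries (q ^ 5) (q ^ 10) * thetaSeries (q ^ 3) (q ^ 10) -
      q * (thetaSeries (q ^ 5) (q ^ 10) * thetaSeries (q ^ 7) (q ^ 10))) * h32' -
    q * (thetaSeries (q ^ 5) (q ^ 5) * thetaSeries 1 (q ^ 5)) * h43 -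
    q * (thetaSeries (q ^ 7) (q ^ 10) * thetaSeries q (q ^ 10) +
      q * (thetaSeries (q ^ 3) (q ^ 10) * thetaSeries (q ^ 9) (q ^ 10))) * h50

theorem thetaSeries_pow_eq {q : ℂ} (hq0 : q ≠ 0) (hq : ‖q‖ < 1) {k l : ℕ} (h : l + k = 5) :
    thetaSeries (q ^ k) (q ^ 5) = qPochInf (-q ^ (k + 5)) (q ^ 10) * qPochInf (-q ^ l) (q ^ 10) *
      qPochInf (q ^ 10) (q ^ 10) := by
  rw [jacobi_triple_product (pow_ne_zero k hq0) (pow_ne_zero 5 hq0)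
    (norm_pow_lt_one hq (by norm_num)), ← pow_add, ← pow_mul]
  rw [show q ^ 5 / q ^ k = q ^ l by
    rw [div_eq_iff (pow_ne_zero k hq0), ← pow_add, h]]

theorem thetaSeries_neg_pow_eq {q : ℂ} (hq0 : q ≠ 0) (hq : ‖q‖ < 1) {k l : ℕ} (h : l + k = 5) :
    thetaSeries (-q ^ k) (q ^ 5) = qPochInf (q ^ (k + 5)) (q ^ 10) * qPochInf (q ^ l) (q ^ 10) *
      qPochInf (q ^ 10) (q ^ 10) := by
  rw [jacobi_triple_product (neg_ne_zero.2 (pow_ne_zero k hq0)) (pow_ne_zero 5 hq0)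
    (norm_pow_lt_one hq (by norm_num)), neg_mul, neg_neg, ← pow_add, ← pow_mul]
  rw [show -(q ^ 5 / -q ^ k) = q ^ l by
    rw [div_neg, neg_neg, div_eq_iff (pow_ne_zero k hq0), ← pow_add, h]]

/-- The relation `theta_identity`, rewritten in infinite products through the Jacobi triple product
and Euler's identity for `q` and for `q ^ 5`. -/
theorem product_identity {q : ℂ} (hq0 : q ≠ 0) (hq : ‖q‖ < 1) :
    qPochInf (-q) q / qPochInf q q * thetaSeries (-1) (q ^ 5) - 1 = 2 * q *
      (qPochInf (q ^ 10) (q ^ 10) / (qPochInf q q * qPochInf q (q ^ 2) *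
          (qPochInf (-q ^ 3) (q ^ 10) * qPochInf (-q ^ 4) (q ^ 10) *
            qPochInf (-q ^ 6) (q ^ 10) * qPochInf (-q ^ 7) (q ^ 10)))) := by
  have hq5 := norm_pow_lt_one hq (m := 5) (by norm_num)
  have hq10 := norm_pow_lt_one hq (m := 10) (by norm_num)
  have hA := qPochInf_dissection q hq (m := 10) (by norm_num)
  have hB := qPochInf_dissection (-q) hq (m := 10) (by norm_num)
  have hO := qPochInf_dissection q (norm_pow_lt_one hq two_ne_zero) (m := 5) (by norm_num)
  have hE := qPochInf_odd_mul_qPochInf_neg hq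
  have hE5 := qPochInf_odd_mul_qPochInf_neg hq5
  rw [qPochInf_dissection (-q ^ 5) hq5 two_ne_zero] at hE5
  -- `(-1; q ^ 10)_∞ = 2 (-q ^ 10; q ^ 10)_∞`
  have h0 := qPochInf_eq_mul (-1) hq10 1
  have hth := theta_identity hq0 hq
  have t0 := thetaSeries_pow_eq hq0 hq (k := 0) (l := 5) rfl
  have t1 := thetaSeries_pow_eq hq0 hq (k := 1) (l := 4) rfl
  have t1' := thetaSeries_neg_pow_eq hq0 hq (k := 1) (l := 4) rfl
  have t0' := thetaSeries_neg_pow_eq hq0 hq (k := 0) (l := 5) rfl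
  rw [pow_one] at t1 t1'
  rw [pow_zero] at t0 t0'
  rw [t0, t1, t1', thetaSeries_pow_eq hq0 hq (k := 2) (l := 3) rfl,
    thetaSeries_pow_eq hq0 hq (k := 3) (l := 2) rfl,
    thetaSeries_pow_eq hq0 hq (k := 4) (l := 1) rfl,
    thetaSeries_pow_eq hq0 hq (k := 5) (l := 0) rfl,
    thetaSeries_neg_pow_eq hq0 hq (k := 2) (l := 3) rfl,
    thetaSeries_neg_pow_eq hq0 hq (k := 3) (l := 2) rfl,
    thetaSeries_neg_pow_eq hq0 hq (k := 4) (l := 1) rfl] at hth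
  rw [hB] at hE
  rw [hO] at hE
  rw [t0', hA, hB, hO]
  have e5 : q ^ 5 * q ^ 5 = q ^ 10 := by ring
  have e52 : (q ^ 5) ^ 2 = q ^ 10 := by ring
  simp only [Finset.prod_range_succ, Finset.prod_range_zero, pow_zero, pow_one, one_mul, mul_one,
    neg_mul, ← pow_mul, ← pow_succ', Nat.reduceMul, Nat.reduceAdd, e5, e52, qPoch_succ, qPoch_zero,
    sub_neg_eq_add] at hth h0 hE hE5 ⊢
  rw [h0] at hth
  have ha : ∀ k : ℕ, k ≠ 0 → qPochInf (q ^ k) (q ^ 10) ≠ 0 := fun k hk =>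
    qPochInf_ne_zero (norm_pow_lt_one hq hk) hq10
  have a1 := ha 1 (by norm_num)
  have a2 := ha 2 (by norm_num)
  have a3 := ha 3 (by norm_num)
  have a4 := ha 4 (by norm_num)
  have a5 := ha 5 (by norm_num)
  have a6 := ha 6 (by norm_num)
  have a7 := ha 7 (by norm_num)
  have a8 := ha 8 (by norm_num)
  have a9 := ha 9 (by norm_num)
  have a10 := ha 10 (by norm_num)
  rw [pow_one] at a1
  have hbn : ∀ k : ℕ, k ≠ 0 → qPochInf (-q ^ k) (q ^ 10) ≠ 0 := fun k hk =>
    qPochInf_ne_zero (by rw [norm_neg]; exact norm_pow_lt_one hq hk) hq10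
  have b3 := hbn 3 (by norm_num)
  have b4 := hbn 4 (by norm_num)
  have b6 := hbn 6 (by norm_num)
  have b7 := hbn 7 (by norm_num)
  clear t0 t1 t0' t1' hA hB hO ha hbn h0
  -- `Ak` and `Bk` stand for `(q ^ k; q ^ 10)_∞` and `(-q ^ k; q ^ 10)_∞`.
  generalize qPochInf q (q ^ 10) = A1, qPochInf (q ^ 2) (q ^ 10) = A2,
    qPochInf (q ^ 3) (q ^ 10) = A3, qPochInf (q ^ 4) (q ^ 10) = A4,
    qPochInf (q ^ 5) (q ^ 10) = A5, qPochInf (q ^ 6) (q ^ 10) = A6,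
    qPochInf (q ^ 7) (q ^ 10) = A7, qPochInf (q ^ 8) (q ^ 10) = A8,
    qPochInf (q ^ 9) (q ^ 10) = A9, qPochInf (q ^ 10) (q ^ 10) = A10,
    qPochInf (-q) (q ^ 10) = B1, qPochInf (-q ^ 2) (q ^ 10) = B2,
    qPochInf (-q ^ 3) (q ^ 10) = B3, qPochInf (-q ^ 4) (q ^ 10) = B4,
    qPochInf (-q ^ 5) (q ^ 10) = B5, qPochInf (-q ^ 6) (q ^ 10) = B6,
    qPochInf (-q ^ 7) (q ^ 10) = B7, qPochInf (-q ^ 8) (q ^ 10) = B8,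
    qPochInf (-q ^ 9) (q ^ 10) = B9, qPochInf (-q ^ 10) (q ^ 10) = B10 at *
  have hth' : B1 * B2 * B3 * B4 * B6 * B7 * B8 * B9 - A1 * A2 * A3 * A4 * A6 * A7 * A8 * A9 =
      2 * q * (B10 ^ 2 * B5 ^ 2 * B1 * B2 * B8 * B9) := by
    refine mul_left_cancel₀ (pow_ne_zero 4 a10) ?_
    linear_combination hth
  have hW : A1 * A2 * A3 * A4 * A5 * A6 * A7 * A8 * A9 * A10 ≠ 0 := by simp [*]
  -- By Euler's identity `hE`, dividing by `(q; q ^ 2)_∞` multiplies by `B1 ⋯ B10`.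
  have hf : A10 / (A1 * A2 * A3 * A4 * A5 * A6 * A7 * A8 * A9 * A10 * (A1 * A3 * A5 * A7 * A9) *
        (B3 * B4 * B6 * B7)) =
      A10 * B1 * B2 * B5 * B8 * B9 * B10 / (A1 * A2 * A3 * A4 * A5 * A6 * A7 * A8 * A9 * A10) := by
    rw [div_eq_div_iff (by simp [*]) hW]
    linear_combination -(A10 * (A1 * A2 * A3 * A4 * A5 * A6 * A7 * A8 * A9 * A10)) * hE
  rw [hf, div_mul_eq_mul_div, div_sub_one hW, mul_div_assoc', div_left_inj' hW]
  linear_combination A5 * A10 * hth' + (B1 * B2 * B3 * B4 * B6 * B7 * B8 * B9 * A5 * A10 +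
    2 * q * A10 * B10 * B5 * B1 * B2 * B8 * B9) * hE5

/-! ### The evaluation of the series -/

theorem theorem5p1 (q : ℂ) (hq : ‖q‖ < 1) :
    HasSum
      (fun n : ℕ =>
        q ^ ((n ^ 2 + 3 * n) / 2) * qPoch (-q) q n /
          (qPoch q (q ^ 2) (n + 1) * qPoch q q (n + 1)))
      (qPochInf (q ^ 10) (q ^ 10) /
        (qPochInf q q * qPochInf q (q ^ 2) *
          (qPochInf (-q ^ 3) (q ^ 10) * qPochInf (-q ^ 4) (q ^ 10) *
            qPochInf (-q ^ 6) (q ^ 10) * qPochInf (-q ^ 7) (q ^ 10)))) := by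
  rcases eq_or_ne q 0 with rfl | hq0
  · have h0 : ∀ r : ℂ, qPochInf 0 r = 1 := fun r => by simp [qPochInf]
    have h1 : ∀ n r, qPoch 0 r n = 1 := fun n r => by simp [qPoch]
    have h := hasSum_single (f := fun n : ℕ => (0 : ℂ) ^ ((n ^ 2 + 3 * n) / 2)) 0 fun n hn => by
      have hn1 := Nat.pos_of_ne_zero hn
      refine zero_pow (Nat.div_ne_zero_iff.2 ⟨two_ne_zero, ?_⟩)
      nlinarith
    simpa [h0, h1] using h
  · -- The `n`-th term, times `2q`, is the `(n + 1)`-st term of the series in `hasSum_bailey`, whose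
    -- `0`-th term is `1`.
    have h := (hasSum_nat_add_iff' 1).2 (hasSum_bailey hq0 hq)
    rw [Finset.sum_range_one] at h
    simp only [qPoch_zero, zero_add, Nat.choose_eq_zero_of_lt one_lt_two, pow_zero, mul_one,
      div_one] at h
    rw [product_identity hq0 hq] at h
    have h2q : 2 * q ≠ 0 := mul_ne_zero two_ne_zero hq0
    rw [← hasSum_mul_left_iff h2q]
    refine h.congr_fun fun n => ?_
    have e1 : qPoch (-1) q (n + 1) = 2 * qPoch (-q) q n := by
      rw [add_comm n, qPoch_add, qPoch_succ]
      norm_num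
    have e2 : (n + 1 + 1).choose 2 = (n ^ 2 + 3 * n) / 2 + 1 := by
      rw [Nat.choose_two_right, ← Nat.add_div_right _ two_pos]
      congr 1
      simp only [Nat.add_sub_cancel]
      ring
    rw [e1, e2]
    ring
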